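/- Notation. For a convex body $K\subset\mathbb{R}^2$ (compact, convex, with non-empty interior) and $p\in(0,\infty)$ let $$h_{p,K}(y)=\log\Big(\int_K e^{p\langle x,y\rangle}\frac{dx}{|K|}\Big)^{1/p},\qquad h_{\infty,K}(y)=\sup_{x\in K}\langle x,y\rangle,$$ and for $p\in(0,\infty]$ let $$\|y\|_{K^{\circ,p}}=\Big(\int_0^\infty r\,e^{-h_{p,K}(ry)}\,dr\Big)^{-1/2}\quad(=0\text{ if the integral diverges}),\qquad K^{\circ,p}=\{y\in\mathbb{R}^2:\|y\|_{K^{\circ,p}}\le 1\}$$ ($K^{\circ,p}$ is the $L^p$-polar of $K$). Let $\mathcal{P}$ be the class of convex polygons $P=\mathrm{co}\{(x_1,y_1),\dots,(x_m,y_m)\}$, $m>3$, whose vertices (extreme points) $(x_1,y_1),\dots,(x_m,y_m)$ are listed in counter-clockwise order, with $x_3\le x_2\le x_1$, $0\le y_1=y_3<y_2$, and with the origin in the interior of $\widehat P=\mathrm{co}\{(x_1,y_1),(x_3,y_3),\dots,(x_m,y_m)\}$. For $s\in\mathbb{R}$ let $P(s)=\mathrm{co}\{(x_1,y_1),(s,y_2),(x_3,y_3),\dots,(x_m,y_m)\}$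 be the polygon obtained by sliding the second vertex horizontally, and let $\xi_\ell,\xi_r\in\mathbb{R}$ be determined by $(x_3,y_3)\in[(\xi_\ell,y_2),(x_4,y_4)]$ and $(x_1,y_1)\in[(\xi_r,y_2),(x_m,y_m)]$. Proposition. Let $p\in(0,\infty]$ and $P\in\mathcal{P}$. For any $s,s'\in[\xi_\ell,\xi_r]$ there exists $x_0\in\mathbb{R}$ such that $(x_0,0)\in\mathrm{int}\,P(s)$, $(-x_0,0)\in\mathrm{int}\,P(s')$, the four areas below are positive and finite, and $$\frac{|(P(s)-(x_0,0))^{\circ,p}\cap\{x>0\}|}{|(P(s)-(x_0,0))^{\circ,p}\cap\{x<0\}|}=\frac{|(P(s')-(-x_0,0))^{\circ,p}\cap\{x>0\}|}{|(P(s')-(-x_0,0))^{\circ,p}\cap\{x<0\}|}.$$ -/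

import Mathlib

open MeasureTheory Set
open scoped ENNReal

noncomputable section

/-- The Euclidean plane. -/
abbrev Plane : Type := EuclideanSpace ℝ (Fin 2)

/-- The `L^p`-support function `h_{p,K}(y) = log ((∫_K e^{p⟨x,y⟩} dx/|K|)^{1/p})` of a planar
convex body `K` for `0 < p < ∞`; for `p = ∞` it is the classical support function
`sup_{x ∈ K} ⟨x,y⟩`. -/
def lpSupport (p : ℝ≥0∞) (K : Set Plane) (y : Plane) : ℝ :=
  if p = ∞ then sSup ((fun x : Plane => inner ℝ x y) '' K)
  else Real.log ((⨍ x in K, Real.exp (p.toReal * inner ℝ x y)) ^ (1 / p.toReal))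

/-- The near norm `‖y‖_{K^{∘,p}} = (1/(n-1)! ∫_0^∞ r^{n-1} e^{-h_{p,K}(ry)} dr)^{-1/n}` for `n = 2`.
It takes values in `[0,∞]`, and is `0` where the integral diverges (for instance at `y = 0`). -/
def lpNearNorm (p : ℝ≥0∞) (K : Set Plane) (y : Plane) : ℝ≥0∞ :=
  (∫⁻ r in Ioi (0 : ℝ), ENNReal.ofReal (r * Real.exp (-lpSupport p K (r • y)))) ^ (-(1 / 2) : ℝ)

/-- The `L^p`-polar body `K^{∘,p} = {y : ‖y‖_{K^{∘,p}} ≤ 1}`. -/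
def lpPolar (p : ℝ≥0∞) (K : Set Plane) : Set Plane :=
  {y | lpNearNorm p K y ≤ 1}

/-- The translate `K - a`. -/
def translateSub (K : Set Plane) (a : Plane) : Set Plane :=
  (fun z => z - a) '' K

/-- The area `|K^{∘,p} ∩ {x > 0}|`. -/
def rightArea (p : ℝ≥0∞) (K : Set Plane) : ℝ≥0∞ :=
  volume (lpPolar p K ∩ {z | 0 < z 0})

/-- The area `|K^{∘,p} ∩ {x < 0}|`. -/
def leftArea (p : ℝ≥0∞) (K : Set Plane) : ℝ≥0∞ :=
  volume (lpPolar p K ∩ {z | z 0 < 0})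

/-- `(b - a) × (c - a)`: positive iff `a, b, c` are the vertices of a nondegenerate triangle,
listed counter-clockwise. -/
def orient (a b c : Plane) : ℝ :=
  (b 0 - a 0) * (c 1 - a 1) - (b 1 - a 1) * (c 0 - a 0)

/-- The class `𝒫` of (labelled) convex polygons with `m = k + 4 > 3` vertices
`(x_1,y_1), …, (x_m,y_m)`. Indices are shifted by one: `vertex 0 = (x_1,y_1)`,
`vertex 1 = (x_2,y_2)` (the sliding vertex), …, `vertex (Fin.last _) = (x_m,y_m)`. -/
structure SlidingPolygon (k : ℕ) where
  /-- the vertices -/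
  vertex : Fin (k + 4) → Plane
  /-- they are extreme points of their convex hull -/
  extreme : ∀ i, vertex i ∈ (convexHull ℝ (range vertex)).extremePoints ℝ
  /-- they are listed in counter-clockwise order around the polygon -/
  ccw : ∀ i j l, i < j → j < l → 0 < orient (vertex i) (vertex j) (vertex l)
  /-- `x_3 ≤ x_2` -/
  x3_le_x2 : vertex 2 0 ≤ vertex 1 0
  /-- `x_2 ≤ x_1` -/
  x2_le_x1 : vertex 1 0 ≤ vertex 0 0
  /-- `0 ≤ y_1` -/
  y1_nonneg : 0 ≤ vertex 0 1
  /-- `y_1 = y_3` -/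
  y1_eq_y3 : vertex 0 1 = vertex 2 1
  /-- `y_1 < y_2` -/
  y1_lt_y2 : vertex 0 1 < vertex 1 1
  /-- the origin is interior to the fixed part `co {(x_1,y_1), (x_3,y_3), …, (x_m,y_m)}` -/
  zero_mem : (0 : Plane) ∈ interior (convexHull ℝ (vertex '' {1}ᶜ))

namespace SlidingPolygon

variable {k : ℕ} (P : SlidingPolygon k)

/-- The polygon `P(s)` obtained by sliding `(x_2,y_2)` horizontally to `(s,y_2)`. -/
def slide (s : ℝ) : Set Plane :=
  convexHull ℝ (range (Function.update P.vertex 1 !₂[s, P.vertex 1 1]))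

/-- `ξ_ℓ`: the line through `(x_4,y_4)` and `(x_3,y_3)` meets `y = y_2` at `(ξ_ℓ,y_2)`. -/
def xiLeft : ℝ :=
  P.vertex 2 0 + (P.vertex 2 0 - P.vertex 3 0) / (P.vertex 2 1 - P.vertex 3 1) *
    (P.vertex 1 1 - P.vertex 2 1)

/-- `ξ_r`: the line through `(x_m,y_m)` and `(x_1,y_1)` meets `y = y_2` at `(ξ_r,y_2)`. -/
def xiRight : ℝ :=
  P.vertex 0 0 +
    (P.vertex 0 0 - P.vertex (Fin.last _) 0) / (P.vertex 0 1 - P.vertex (Fin.last _) 1) *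
      (P.vertex 1 1 - P.vertex 0 1)

/-- The vertices after the third lie strictly below the line `y = y_1`, so the denominators in
`xiLeft` and `xiRight` are positive. -/
theorem vertex_lt (l : Fin (k + 4)) (hl : 2 < l) : P.vertex l 1 < P.vertex 0 1 := by
  have h := P.ccw 0 2 l (by simp [Fin.lt_def, Nat.mod_eq_of_lt]) hl
  have h1 := P.x3_le_x2
  have h2 := P.x2_le_x1
  have h3 := P.y1_eq_y3
  simp only [orient] at h
  rw [← h3] at h
  by_contra hc
  push Not at hc
  nlinarith [mul_nonneg (sub_nonneg.2 (h1.trans h2)) (sub_nonneg.2 hc)]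

theorem mem_segment_xiLeft :
    P.vertex 2 ∈ segment ℝ (!₂[P.xiLeft, P.vertex 1 1] : Plane) (P.vertex 3) := by
  have h3 := P.vertex_lt 3 (by simp [Fin.lt_def, Nat.mod_eq_of_lt])
  have h1 := P.y1_eq_y3
  have h2 := P.y1_lt_y2
  have hd : 0 < P.vertex 2 1 - P.vertex 3 1 := by linarith
  have he : 0 < P.vertex 1 1 - P.vertex 2 1 := by linarith
  have hs : 0 < P.vertex 1 1 - P.vertex 3 1 := by linarith
  refine ⟨(P.vertex 2 1 - P.vertex 3 1) / (P.vertex 1 1 - P.vertex 3 1),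
    (P.vertex 1 1 - P.vertex 2 1) / (P.vertex 1 1 - P.vertex 3 1), by positivity, by positivity,
    by field_simp; ring, ?_⟩
  ext i
  fin_cases i <;> simp [xiLeft] <;> field_simp <;> ring

theorem mem_segment_xiRight :
    P.vertex 0 ∈ segment ℝ (!₂[P.xiRight, P.vertex 1 1] : Plane) (P.vertex (Fin.last _)) := by
  have h3 := P.vertex_lt (Fin.last _) (by simp [Fin.lt_def, Nat.mod_eq_of_lt])
  have h2 := P.y1_lt_y2
  have hd : 0 < P.vertex 0 1 - P.vertex (Fin.last _) 1 := by linarith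
  have he : 0 < P.vertex 1 1 - P.vertex 0 1 := by linarith
  have hs : 0 < P.vertex 1 1 - P.vertex (Fin.last _) 1 := by linarith
  refine ⟨(P.vertex 0 1 - P.vertex (Fin.last _) 1) / (P.vertex 1 1 - P.vertex (Fin.last _) 1),
    (P.vertex 1 1 - P.vertex 0 1) / (P.vertex 1 1 - P.vertex (Fin.last _) 1), by positivity,
    by positivity, by field_simp; ring, ?_⟩
  ext i
  fin_cases i <;> simp [xiRight] <;> field_simp <;> ring

end SlidingPolygon

end

/-! In polar coordinates, the area of `K^{∘,p}` inside a cone is half the integral of `e^{-h_{p,K}}`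
over that cone (`volume_polar_inter_cone`). Replacing `K` by `K - (x,0)` multiplies this density by
`e^{x y₀}` (`lpSupport_translateSub`), so both half-plane areas are half a `tiltedMass` in the one
variable `x`. The right mass increases with `x` and the left mass decreases; both are finite and
continuous while `(x,0)` is interior to `K`.

Write `R, L` for the masses of `K = P(s)` at `x` and `R', L'` for those of `K' = P(s')` at `-x`. The
claim is `L R' = R L'`. Admissible `x` form a bounded open interval around `0`. Near its right end
`(x,0)` leaves `K` or `(-x,0)` leaves `K'`, so `R` or `L'` blows up (`exists_lt_tiltedMass`), while
`L R'` stays below its value at `0`; hence `L R' ≤ R L'` somewhere. Exchanging `K` and `K'` and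
reflecting `x` gives the reverse inequality, and the intermediate value theorem concludes. -/

noncomputable section

/-! ### The `L^p`-support function: continuity, translation, linear bounds. -/

section Support

variable {p : ℝ≥0∞} {K : Set Plane}

theorem continuous_expInner (c : ℝ) :
    Continuous (fun z : Plane × Plane => Real.exp (c * inner ℝ z.2 z.1)) := by fun_prop

theorem integrableOn_expInner (hK : IsCompact K) (c : ℝ) (y : Plane) :
    IntegrableOn (fun x : Plane => Real.exp (c * inner ℝ x y)) K :=
  ContinuousOn.integrableOn_compact hK (by fun_prop)

theorem average_expInner_pos (hK : IsCompact K) (hK0 : 0 < volume K) (c : ℝ) (y : Plane) :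
    0 < ⨍ x in K, Real.exp (c * inner ℝ x y) := by
  rw [setAverage_eq, smul_eq_mul]
  have h1 : 0 < volume.real K := ENNReal.toReal_pos hK0.ne' hK.measure_lt_top.ne
  have h2 : 0 < ∫ x in K, Real.exp (c * inner ℝ x y) := by
    rw [setIntegral_pos_iff_support_of_nonneg_ae
      (Filter.Eventually.of_forall fun x => (Real.exp_pos _).le) (integrableOn_expInner hK c y)]
    convert hK0
    ext x
    simp [(Real.exp_pos _).ne']
  positivity

theorem lpSupport_top (y : Plane) :
    lpSupport ∞ K y = sSup ((fun x : Plane => inner ℝ x y) '' K) := by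
  simp [lpSupport]

theorem lpSupport_of_ne_top (hp : p ≠ ∞) (hK : IsCompact K) (hK0 : 0 < volume K) (y : Plane) :
    lpSupport p K y =
      1 / p.toReal * Real.log (⨍ x in K, Real.exp (p.toReal * inner ℝ x y)) := by
  rw [lpSupport, if_neg hp, Real.log_rpow (average_expInner_pos hK hK0 _ _)]

theorem continuous_lpSupport (hK : IsCompact K) (hK0 : 0 < volume K) :
    Continuous (lpSupport p K) := by
  by_cases hp : p = ∞
  · subst hp
    rw [show lpSupport ∞ K = fun y => sSup ((fun x : Plane => inner ℝ x y) '' K) from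
      funext lpSupport_top]
    exact hK.continuous_sSup (f := fun y x : Plane => inner ℝ x y)
      (by simp only [Function.HasUncurry.uncurry, id]; fun_prop)
  · rw [show lpSupport p K = fun y => 1 / p.toReal *
        Real.log (⨍ x in K, Real.exp (p.toReal * inner ℝ x y)) from
      funext (lpSupport_of_ne_top hp hK hK0)]
    refine continuous_const.mul (Continuous.log ?_ fun y => (average_expInner_pos hK hK0 _ _).ne')
    simp only [setAverage_eq, smul_eq_mul]
    exact continuous_const.mul (continuous_parametric_integral_of_continuous (μ := volume)
      (f := fun y x : Plane => Real.exp (p.toReal * inner ℝ x y)) (continuous_expInner _) hK)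

theorem measurePreserving_sub_const (a : Plane) :
    MeasurePreserving (fun z : Plane => z - a) :=
  measurePreserving_sub_right volume a

theorem measurableEmbedding_sub_const (a : Plane) :
    MeasurableEmbedding (fun z : Plane => z - a) := by
  simpa [sub_eq_add_neg] using measurableEmbedding_addRight (-a)

theorem volume_translateSub (a : Plane) : volume (translateSub K a) = volume K := by
  rw [translateSub, ← (measurePreserving_sub_const a).measure_preimage_emb
    (measurableEmbedding_sub_const a), preimage_image_eq _ (sub_left_injective (b := a))]

theorem isCompact_translateSub (hK : IsCompact K) (a : Plane) : IsCompact (translateSub K a) :=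
  hK.image (by fun_prop)

/-- Translation multiplies the exponential average by `e^{-p⟨a,y⟩}`, and for `p = ∞` shifts the
supremum. Thus all translates of `K` are governed by tilts of one fixed density. -/
theorem lpSupport_translateSub (hp : 0 < p) (hK : IsCompact K) (hK0 : 0 < volume K)
    (a y : Plane) : lpSupport p (translateSub K a) y = lpSupport p K y - inner ℝ a y := by
  by_cases hpt : p = ∞
  · subst hpt
    have hne : K.Nonempty := nonempty_of_measure_ne_zero hK0.ne'
    rw [lpSupport_top, lpSupport_top, translateSub, image_image]
    have hf : Continuous fun x : Plane => (inner ℝ x y : ℝ) := by fun_prop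
    have h := (OrderIso.addRight (-inner ℝ a y)).map_csSup' (hne.image fun x : Plane => inner ℝ x y)
      (hK.image hf).bddAbove
    rw [image_image] at h
    simp_rw [inner_sub_left]
    simpa [sub_eq_add_neg] using h.symm
  · rw [lpSupport_of_ne_top hpt (isCompact_translateSub hK a) (by rwa [volume_translateSub]),
      lpSupport_of_ne_top hpt hK hK0]
    have hpr : 0 < p.toReal := ENNReal.toReal_pos hp.ne' hpt
    have h : ⨍ x in translateSub K a, Real.exp (p.toReal * inner ℝ x y) =
        Real.exp (-(p.toReal * inner ℝ a y)) * ⨍ x in K, Real.exp (p.toReal * inner ℝ x y) := by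
      rw [setAverage_eq, setAverage_eq, measureReal_def, volume_translateSub, ← measureReal_def,
        translateSub, (measurePreserving_sub_const a).setIntegral_image_emb
          (measurableEmbedding_sub_const a), smul_eq_mul, smul_eq_mul, mul_left_comm]
      congr 1
      rw [← integral_const_mul]
      congr 1
      funext x
      rw [← Real.exp_add, inner_sub_left]
      congr 1; ring
    rw [h, Real.log_mul (Real.exp_pos _).ne' (average_expInner_pos hK hK0 _ _).ne', Real.log_exp]
    field_simp
    ring

theorem lpSupport_le (hp : 0 < p) (hK : IsCompact K) (hK0 : 0 < volume K) {y : Plane} {M : ℝ}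
    (hM : ∀ x ∈ K, inner ℝ x y ≤ M) : lpSupport p K y ≤ M := by
  by_cases hpt : p = ∞
  · subst hpt
    rw [lpSupport_top]
    exact csSup_le ((nonempty_of_measure_ne_zero hK0.ne').image _) (by simpa using hM)
  · have hpr : 0 < p.toReal := ENNReal.toReal_pos hp.ne' hpt
    rw [lpSupport_of_ne_top hpt hK hK0, one_div_mul_eq_div, div_le_iff₀ hpr,
      Real.log_le_iff_le_exp (average_expInner_pos hK hK0 _ _), setAverage_eq, smul_eq_mul]
    have h1 : 0 < volume.real K := ENNReal.toReal_pos hK0.ne' hK.measure_lt_top.ne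
    rw [inv_mul_le_iff₀ h1]
    calc ∫ x in K, Real.exp (p.toReal * inner ℝ x y)
        ≤ ∫ _x in K, Real.exp (M * p.toReal) := by
          refine setIntegral_mono_on (integrableOn_expInner hK _ y)
            (integrableOn_const hK.measure_lt_top.ne) hK.measurableSet fun x hx => ?_
          have := mul_le_mul_of_nonneg_left (hM x hx) hpr.le
          exact Real.exp_le_exp.2 (by linarith)
      _ = _ := by simp

/-- A ball of fixed radius in `K`, displaced from `q` in the direction of `y`, already contributes
`⟨q,y⟩ + ρ‖y‖`; restricting the average to it costs only a volume ratio independent of `y`. This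
makes the density tilted by an interior point `q` integrable. -/
theorem exists_le_lpSupport (hp : 0 < p) (hK : IsCompact K) {q : Plane} {ρ : ℝ} (hρ : 0 < ρ)
    (hball : Metric.closedBall q (2 * ρ) ⊆ K) :
    ∃ C, ∀ y, inner ℝ q y + ρ * ‖y‖ - C ≤ lpSupport p K y := by
  have hK0 : 0 < volume K :=
    (Metric.measure_closedBall_pos volume q (by positivity)).trans_le (measure_mono hball)
  have key : ∀ y : Plane, ∃ w : Plane, Metric.closedBall w (ρ / 2) ⊆ K ∧
      ∀ x ∈ Metric.closedBall w (ρ / 2), inner ℝ q y + ρ * ‖y‖ ≤ inner ℝ x y := by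
    intro y
    -- The displacement `3ρ/2` works because `3ρ/2 + ρ/2 = 2ρ` keeps the ball in `K` and `3ρ/2 - ρ/2
    -- = ρ` is the gain. For `y = 0`, division by zero makes the centre `q`.
    refine ⟨q + (3 * ρ / 2 / ‖y‖) • y, fun x hx => hball ?_, fun x hx => ?_⟩
    · have h : ‖(3 * ρ / 2 / ‖y‖) • y‖ ≤ 3 * ρ / 2 := by
        rw [norm_smul, Real.norm_of_nonneg (by positivity)]
        rcases eq_or_ne y 0 with rfl | hy
        · simpa using by positivity
        · rw [div_mul_cancel₀ _ (norm_ne_zero_iff.2 hy)]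
      rw [mem_closedBall_iff_norm] at hx ⊢
      have := norm_add_le (x - (q + (3 * ρ / 2 / ‖y‖) • y)) ((3 * ρ / 2 / ‖y‖) • y)
      rw [show x - (q + (3 * ρ / 2 / ‖y‖) • y) + (3 * ρ / 2 / ‖y‖) • y = x - q by abel] at this
      linarith
    · rw [mem_closedBall_iff_norm] at hx
      rcases eq_or_ne y 0 with rfl | hy
      · simp
      have hy' : 0 < ‖y‖ := norm_pos_iff.2 hy
      have h1 := (abs_le.1 (abs_real_inner_le_norm (x - (q + (3 * ρ / 2 / ‖y‖) • y)) y)).1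
      rw [inner_sub_left, inner_add_left, real_inner_smul_left, real_inner_self_eq_norm_sq] at h1
      have h2 : 3 * ρ / 2 / ‖y‖ * ‖y‖ ^ 2 = 3 * ρ / 2 * ‖y‖ := by field_simp
      rw [h2] at h1
      have h3 := mul_le_mul_of_nonneg_right hx hy'.le
      linarith
  by_cases hpt : p = ∞
  · subst hpt
    refine ⟨0, fun y => ?_⟩
    obtain ⟨w, hw, hw'⟩ := key y
    have hwm : w ∈ Metric.closedBall w (ρ / 2) := Metric.mem_closedBall_self (by positivity)
    rw [lpSupport_top, sub_zero]
    have hf : Continuous fun x : Plane => (inner ℝ x y : ℝ) := by fun_prop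
    exact (hw' w hwm).trans (le_csSup (hK.image hf).bddAbove ⟨w, hw hwm, rfl⟩)
  · have hpr : 0 < p.toReal := ENNReal.toReal_pos hp.ne' hpt
    have hV : 0 < volume.real K := ENNReal.toReal_pos hK0.ne' hK.measure_lt_top.ne
    set v := volume.real (Metric.closedBall (0 : Plane) (ρ / 2)) with hv
    have hv0 : 0 < v := ENNReal.toReal_pos
      (Metric.measure_closedBall_pos volume _ (by positivity)).ne' measure_closedBall_lt_top.ne
    refine ⟨-(1 / p.toReal * Real.log (v / volume.real K)), fun y => ?_⟩
    obtain ⟨w, hw, hw'⟩ := key y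
    have hvw : volume.real (Metric.closedBall w (ρ / 2)) = v := by
      rw [hv, measureReal_def, measureReal_def, Measure.addHaar_closedBall_center]
    have hint : Real.exp (p.toReal * (inner ℝ q y + ρ * ‖y‖)) * v ≤
        ∫ x in K, Real.exp (p.toReal * inner ℝ x y) := by
      calc Real.exp (p.toReal * (inner ℝ q y + ρ * ‖y‖)) * v
          = ∫ _x in Metric.closedBall w (ρ / 2),
              Real.exp (p.toReal * (inner ℝ q y + ρ * ‖y‖)) := by
            rw [setIntegral_const, hvw, smul_eq_mul, mul_comm]
        _ ≤ ∫ x in Metric.closedBall w (ρ / 2), Real.exp (p.toReal * inner ℝ x y) := by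
            refine setIntegral_mono_on (integrableOn_const measure_closedBall_lt_top.ne)
              ((integrableOn_expInner hK _ y).mono_set hw) measurableSet_closedBall fun x hx => ?_
            exact Real.exp_le_exp.2 (mul_le_mul_of_nonneg_left (hw' x hx) hpr.le)
        _ ≤ _ := setIntegral_mono_set (integrableOn_expInner hK _ y)
            (Filter.Eventually.of_forall fun x => (Real.exp_pos _).le) hw.eventuallyLE
    have havg : Real.exp (p.toReal * (inner ℝ q y + ρ * ‖y‖)) * (v / volume.real K) ≤
        ⨍ x in K, Real.exp (p.toReal * inner ℝ x y) := by
      rw [setAverage_eq, smul_eq_mul, ← mul_div_assoc, ← div_eq_inv_mul]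
      gcongr
    have hlog := Real.log_le_log (by positivity) havg
    rw [Real.log_mul (Real.exp_pos _).ne' (by positivity), Real.log_exp] at hlog
    rw [lpSupport_of_ne_top hpt hK hK0]
    calc _ = 1 / p.toReal * (p.toReal * (inner ℝ q y + ρ * ‖y‖) +
          Real.log (v / volume.real K)) := by field_simp; ring
      _ ≤ _ := by gcongr

end Support

/-! ### Areas of polar sets in cones, by polar coordinates. -/

section Polar

/-- The unit vector with angle `θ`. -/
def unitVec (θ : ℝ) : Plane := !₂[Real.cos θ, Real.sin θ]

theorem lintegral_plane_eq_polar {f : Plane → ℝ≥0∞} (hf : Measurable f) :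
    ∫⁻ y, f y = ∫⁻ θ in Ioo (-Real.pi) Real.pi, ∫⁻ r in Ioi (0 : ℝ),
      ENNReal.ofReal r * f (r • unitVec θ) := by
  have e : MeasurePreserving ((MeasurableEquiv.finTwoArrow (α := ℝ)).symm.trans
      (MeasurableEquiv.toLp 2 (Fin 2 → ℝ))) :=
    (PiLp.volume_preserving_toLp (Fin 2)).comp (volume_preserving_finTwoArrow ℝ).symm
  rw [← e.lintegral_comp_emb (MeasurableEquiv.measurableEmbedding _),
    ← lintegral_comp_polarCoord_symm, polarCoord_target, Measure.volume_eq_prod,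
    ← Measure.prod_restrict, lintegral_prod_symm]
  · refine lintegral_congr fun θ => lintegral_congr fun r => ?_
    rw [smul_eq_mul]
    congr 2
    ext i
    fin_cases i <;> simp [unitVec, polarCoord_symm_apply]
  · refine Measurable.aemeasurable ?_
    simp only [smul_eq_mul]
    refine (by fun_prop : Measurable fun a : ℝ × ℝ => ENNReal.ofReal a.1).mul
      (hf.comp ((MeasurableEquiv.measurable _).comp ?_))
    exact continuous_polarCoord_symm.measurable

/-- This is the radial integral over `0 < r ≤ √N`, with `N = ∞` allowed. On a ray the polar set has
exactly this form. -/
theorem lintegral_Ioi_ofReal_indicator_sq_le (N : ℝ≥0∞) :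
    ∫⁻ r in Ioi (0 : ℝ), ENNReal.ofReal r * {t : ℝ | ENNReal.ofReal (t ^ 2) ≤ N}.indicator 1 r =
      N / 2 := by
  have key : ∀ T : ℝ, 0 ≤ T → ∫⁻ r in Ioc 0 T, ENNReal.ofReal r = ENNReal.ofReal (T ^ 2) / 2 := by
    intro T hT
    rw [← ofReal_integral_eq_lintegral_ofReal]
    · rw [← intervalIntegral.integral_of_le hT, integral_id, ENNReal.ofReal_div_of_pos two_pos]
      simp
    · exact (continuous_id.integrableOn_Icc).mono_set Ioc_subset_Icc_self
    · exact (ae_restrict_mem measurableSet_Ioc).mono fun r hr => hr.1.le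
  rcases eq_or_ne N ∞ with rfl | hN
  · simp only [le_top, ofPred_true, indicator_univ, Pi.one_apply, mul_one]
    rw [ENNReal.top_div_of_ne_top (by simp)]
    -- The cutoff `c + 2` suffices since `(c + 2)² / 2 ≥ c`.
    refine ENNReal.eq_top_of_forall_nnreal_le fun c => ?_
    have h := (key (c + 2) (by positivity)).symm.le.trans
      (lintegral_mono_set (μ := volume) Ioc_subset_Ioi_self)
    refine le_trans ?_ h
    rw [ENNReal.le_div_iff_mul_le (by simp) (by simp), ← ENNReal.ofReal_coe_nnreal,
      ← ENNReal.ofReal_ofNat 2, ← ENNReal.ofReal_mul (by positivity)]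
    exact ENNReal.ofReal_le_ofReal (by nlinarith [c.coe_nonneg])
  · obtain ⟨T, hT, hTN⟩ : ∃ T : ℝ, 0 ≤ T ∧ N = ENNReal.ofReal (T ^ 2) :=
      ⟨√N.toReal, Real.sqrt_nonneg _, by
        rw [Real.sq_sqrt ENNReal.toReal_nonneg, ENNReal.ofReal_toReal hN]⟩
    rw [hTN, ← key T hT, ← lintegral_indicator measurableSet_Ioi,
      ← lintegral_indicator measurableSet_Ioc]
    refine lintegral_congr fun r => ?_
    by_cases hr : 0 < r
    · by_cases hrT : r ≤ T
      · have h : ENNReal.ofReal (r ^ 2) ≤ ENNReal.ofReal (T ^ 2) :=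
          ENNReal.ofReal_le_ofReal (by gcongr)
        simp [indicator, hr, hrT, h]
      · have h : ¬ ENNReal.ofReal (r ^ 2) ≤ ENNReal.ofReal (T ^ 2) := by
          rw [ENNReal.ofReal_le_ofReal_iff (by positivity), sq_le_sq₀ hr.le hT]
          exact hrT
        simp only [indicator, mem_Ioi, mem_Ioc, mem_ofPred_eq, hr, hrT, h]
        simp
    · simp [indicator, hr]

theorem rpow_neg_half_le_one_iff (N : ℝ≥0∞) : N ^ (-(1 / 2) : ℝ) ≤ 1 ↔ 1 ≤ N := by
  rw [ENNReal.rpow_neg, ENNReal.inv_le_one]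
  constructor
  · intro h
    by_contra hN
    exact absurd (ENNReal.rpow_lt_one (not_le.1 hN) (by norm_num)) (not_lt.2 h)
  · intro h
    exact ENNReal.one_le_rpow h (by norm_num)

theorem lintegral_Ioi_comp_mul_left {a : ℝ} (ha : 0 < a) (g : ℝ → ℝ≥0∞) :
    ENNReal.ofReal a * ∫⁻ r in Ioi (0 : ℝ), g (a * r) = ∫⁻ r in Ioi (0 : ℝ), g r := by
  have h := lintegral_image_eq_lintegral_abs_deriv_mul (s := Ioi (0 : ℝ)) (f := fun r => a * r)
    (f' := fun _ => a) measurableSet_Ioi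
    (fun x _ => by simpa using ((hasDerivAt_id x).const_mul a).hasDerivWithinAt)
    ((mul_right_injective₀ ha.ne').injOn) g
  rw [image_mul_left_Ioi ha, mul_zero, abs_of_pos ha, lintegral_const_mul' _ _ (by simp)] at h
  exact h.symm

/-- The area of the polar set in a cone is half the integral of `e^{-h}` over that cone. -/
theorem volume_polar_inter_cone {h : Plane → ℝ} (hh : Continuous h) {C : Set Plane}
    (hC : MeasurableSet C) (hcone : ∀ r : ℝ, 0 < r → ∀ y, r • y ∈ C ↔ y ∈ C) :
    volume ({y | (∫⁻ r in Ioi (0 : ℝ), ENNReal.ofReal (r * Real.exp (-h (r • y)))) ^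
        (-(1 / 2) : ℝ) ≤ 1} ∩ C) = (∫⁻ y in C, ENNReal.ofReal (Real.exp (-h y))) / 2 := by
  set N : Plane → ℝ≥0∞ :=
    fun y => ∫⁻ r in Ioi (0 : ℝ), ENNReal.ofReal (r * Real.exp (-h (r • y))) with hN
  have hNm : Measurable N := by
    refine Measurable.lintegral_prod_right' (f := fun z : Plane × ℝ =>
      ENNReal.ofReal (z.2 * Real.exp (-h (z.2 • z.1)))) ?_
    exact (by fun_prop : Continuous fun z : Plane × ℝ => z.2 * Real.exp (-h (z.2 • z.1)))
      |>.measurable.ennreal_ofReal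
  -- `N` is homogeneous of degree `-2`, so `r • ω` lies in the polar set exactly when `r² ≤ N ω`.
  have hscale : ∀ t : ℝ, 0 < t → ∀ y, ENNReal.ofReal (t ^ 2) * N (t • y) = N y := by
    intro t ht y
    rw [hN]
    dsimp only
    rw [← lintegral_Ioi_comp_mul_left ht
      (fun r => ENNReal.ofReal (r * Real.exp (-h (r • y)))), sq, ENNReal.ofReal_mul ht.le, mul_assoc,
      ← lintegral_const_mul' _ _ (by simp)]
    congr 1
    refine lintegral_congr fun r => ?_
    rw [← ENNReal.ofReal_mul ht.le, smul_smul, mul_comm r t]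
    congr 1; ring
  have hset : {y | N y ^ (-(1 / 2) : ℝ) ≤ 1} = {y | 1 ≤ N y} := by
    ext y; exact rpow_neg_half_le_one_iff _
  have hpm : MeasurableSet {y | 1 ≤ N y} := measurableSet_le measurable_const hNm
  rw [hset, ← lintegral_indicator_one (hpm.inter hC), ← lintegral_indicator hC,
    lintegral_plane_eq_polar ((measurable_one).indicator (hpm.inter hC)),
    lintegral_plane_eq_polar (Measurable.indicator (by fun_prop) hC), ENNReal.div_eq_inv_mul,
    ← lintegral_const_mul' _ _ (by simp)]
  -- The identity holds ray by ray: both sides are `N (unitVec θ) / 2` for directions in `C`, and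
  -- `0` otherwise.
  refine lintegral_congr fun θ => ?_
  rw [← ENNReal.div_eq_inv_mul]
  by_cases hθ : unitVec θ ∈ C
  · have h1 : ∫⁻ r in Ioi (0 : ℝ), ENNReal.ofReal r *
        C.indicator (fun y => ENNReal.ofReal (Real.exp (-h y))) (r • unitVec θ) =
        N (unitVec θ) := by
      refine setLIntegral_congr_fun measurableSet_Ioi fun r hr => ?_
      rw [indicator_of_mem ((hcone r hr _).2 hθ), ← ENNReal.ofReal_mul (le_of_lt hr)]
    rw [h1, ← lintegral_Ioi_ofReal_indicator_sq_le]
    refine setLIntegral_congr_fun measurableSet_Ioi fun r hr => ?_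
    have hr' : 0 < r := hr
    have hiff : 1 ≤ N (r • unitVec θ) ↔ ENNReal.ofReal (r ^ 2) ≤ N (unitVec θ) := by
      have h0 : ENNReal.ofReal (r ^ 2) ≠ 0 := by simp [hr'.ne']
      conv_rhs => rw [← hscale r hr', ← mul_one (ENNReal.ofReal (r ^ 2)), mul_assoc, one_mul]
      exact (ENNReal.mul_le_mul_iff_right h0 (by simp)).symm
    congr 1
    simp [indicator, (hcone r hr' _).2 hθ, hiff]
  · have h1 : ∀ r ∈ Ioi (0 : ℝ), r • unitVec θ ∉ C := fun r hr => by rwa [hcone r hr]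
    have h2 : ∀ f : Plane → ℝ≥0∞, ∀ S ⊆ C,
        ∫⁻ r in Ioi (0 : ℝ), ENNReal.ofReal r * S.indicator f (r • unitVec θ) = 0 := by
      intro f S hS
      rw [setLIntegral_congr_fun (g := fun _ => 0) measurableSet_Ioi, lintegral_zero]
      intro r hr
      beta_reduce
      rw [indicator_of_notMem fun h => h1 r hr (hS h), mul_zero]
    rw [h2 _ _ inter_subset_right, h2 _ _ subset_rfl, ENNReal.zero_div]

end Polar

/-! ### Tilted masses: finiteness, monotonicity, continuity, blow-up at the boundary. -/

section TiltedMass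

/-- A planar convex body with the origin in its interior. -/
structure IsCenteredBody (K : Set Plane) : Prop where
  isCompact : IsCompact K
  convex : Convex ℝ K
  zero_mem : (0 : Plane) ∈ interior K

theorem IsCenteredBody.volume_pos {K : Set Plane} (hK : IsCenteredBody K) : 0 < volume K :=
  Measure.measure_pos_of_nonempty_interior _ ⟨0, hK.zero_mem⟩

/-- The point `(x, 0)`. -/
def axisPoint (x : ℝ) : Plane := !₂[x, 0]

theorem axisPoint_zero : axisPoint 0 = 0 := by
  ext i; fin_cases i <;> simp [axisPoint]

theorem continuous_axisPoint : Continuous axisPoint := by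
  refine (PiLp.continuous_toLp 2 _).comp (continuous_pi fun i => ?_)
  fin_cases i
  · exact continuous_id
  · exact continuous_const

theorem inner_axisPoint (x : ℝ) (y : Plane) : inner ℝ (axisPoint x) y = x * y 0 := by
  simp [axisPoint, PiLp.inner_apply, Fin.sum_univ_two, mul_comm]

/-- The integral over `C` of `exp(⟨(x, 0), y⟩ - h_{p,K}(y))`. -/
def tiltedMass (p : ℝ≥0∞) (K C : Set Plane) (x : ℝ) : ℝ≥0∞ :=
  ∫⁻ y in C, ENNReal.ofReal (Real.exp (x * y 0 - lpSupport p K y))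

/-- The open right half plane. -/
def rightHalf : Set Plane := {z | 0 < z 0}

/-- The open left half plane. -/
def leftHalf : Set Plane := {z | z 0 < 0}

theorem isOpen_rightHalf : IsOpen rightHalf :=
  isOpen_lt continuous_const (by fun_prop : Continuous fun z : Plane => z 0)

theorem isOpen_leftHalf : IsOpen leftHalf :=
  isOpen_lt (by fun_prop : Continuous fun z : Plane => z 0) continuous_const

theorem rightHalf_nonempty : rightHalf.Nonempty := ⟨axisPoint 1, by simp [rightHalf, axisPoint]⟩

theorem leftHalf_nonempty : leftHalf.Nonempty := ⟨axisPoint (-1), by simp [leftHalf, axisPoint]⟩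

variable {p : ℝ≥0∞} {K C : Set Plane}

theorem volume_lpPolar_translateSub_inter (hp : 0 < p) (hK : IsCenteredBody K)
    (hC : MeasurableSet C) (hcone : ∀ r : ℝ, 0 < r → ∀ y, r • y ∈ C ↔ y ∈ C) (x : ℝ) :
    volume (lpPolar p (translateSub K (axisPoint x)) ∩ C) = tiltedMass p K C x / 2 := by
  have hc := isCompact_translateSub hK.isCompact (axisPoint x)
  have hv : 0 < volume (translateSub K (axisPoint x)) := by
    rw [volume_translateSub]; exact hK.volume_pos
  refine (volume_polar_inter_cone (continuous_lpSupport hc hv) hC hcone).trans ?_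
  rw [tiltedMass]
  congr 1
  refine lintegral_congr fun y => ?_
  rw [lpSupport_translateSub hp hK.isCompact hK.volume_pos, inner_axisPoint, neg_sub]

theorem rightArea_eq (hp : 0 < p) (hK : IsCenteredBody K) (x : ℝ) :
    rightArea p (translateSub K (axisPoint x)) = tiltedMass p K rightHalf x / 2 :=
  volume_lpPolar_translateSub_inter hp hK isOpen_rightHalf.measurableSet
    (fun r hr y => by simp [rightHalf, hr]) x

theorem leftArea_eq (hp : 0 < p) (hK : IsCenteredBody K) (x : ℝ) :
    leftArea p (translateSub K (axisPoint x)) = tiltedMass p K leftHalf x / 2 :=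
  volume_lpPolar_translateSub_inter hp hK isOpen_leftHalf.measurableSet
    (fun r hr y => by simp [leftHalf, mul_neg_iff, hr, hr.not_gt]) x

theorem measurable_tilted (hK : IsCenteredBody K) (x : ℝ) :
    Measurable fun y : Plane => ENNReal.ofReal (Real.exp (x * y 0 - lpSupport p K y)) := by
  have := continuous_lpSupport (p := p) hK.isCompact hK.volume_pos
  exact (by fun_prop : Continuous fun y : Plane => Real.exp (x * y 0 - lpSupport p K y))
    |>.measurable.ennreal_ofReal

theorem tiltedMass_pos (hK : IsCenteredBody K) (hC : IsOpen C) (hne : C.Nonempty) (x : ℝ) :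
    0 < tiltedMass p K C x := by
  rw [tiltedMass, setLIntegral_pos_iff (measurable_tilted hK x)]
  convert hC.measure_pos volume hne
  rw [inter_eq_right]
  intro y _
  simp [Real.exp_pos]

/-- The cubic term of the exponential series gives a bound by a multiple of `(1 + ‖y‖)^{-3}`,
integrable in the plane because `3 > 2`. -/
theorem lintegral_exp_neg_mul_norm_lt_top {ρ : ℝ} (hρ : 0 < ρ) (B : ℝ) :
    ∫⁻ y : Plane, ENNReal.ofReal (Real.exp (B - ρ * ‖y‖)) < ∞ := by
  have hint : Integrable fun y : Plane =>
      Real.exp B * (Real.exp ρ * 6 / ρ ^ 3) * (1 + ‖y‖) ^ (-3 : ℝ) :=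
    (integrable_one_add_norm (E := Plane) (μ := volume) (r := 3) (by norm_num)).const_mul _
  refine lt_of_le_of_lt (lintegral_mono fun y => ENNReal.ofReal_le_ofReal ?_) hint.lintegral_lt_top
  have h1 := Real.pow_div_factorial_le_exp (ρ * (1 + ‖y‖)) (by positivity) 3
  have h2 : (1 + ‖y‖) ^ (-3 : ℝ) = ((1 + ‖y‖) ^ 3)⁻¹ := by
    rw [Real.rpow_neg (by positivity)]; norm_cast
  have h3 : Real.exp (B - ρ * ‖y‖) = Real.exp B * Real.exp ρ / Real.exp (ρ * (1 + ‖y‖)) := by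
    rw [← Real.exp_add, ← Real.exp_sub]; congr 1; ring
  have h4 : (0 : ℝ) < (ρ * (1 + ‖y‖)) ^ 3 / (Nat.factorial 3 : ℝ) := by positivity
  rw [h2, h3]
  calc Real.exp B * Real.exp ρ / Real.exp (ρ * (1 + ‖y‖))
      ≤ Real.exp B * Real.exp ρ / ((ρ * (1 + ‖y‖)) ^ 3 / (Nat.factorial 3 : ℝ)) := by gcongr
    _ = _ := by
      rw [show (Nat.factorial 3 : ℝ) = 6 by norm_num [Nat.factorial]]
      field_simp

theorem tiltedMass_lt_top (hp : 0 < p) (hK : IsCenteredBody K) (C : Set Plane) {x : ℝ}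
    (hx : axisPoint x ∈ interior K) : tiltedMass p K C x < ∞ := by
  obtain ⟨ε, hε, hball⟩ := Metric.nhds_basis_closedBall.mem_iff.1 (mem_interior_iff_mem_nhds.1 hx)
  obtain ⟨B, hB⟩ := exists_le_lpSupport (ρ := ε / 2) hp hK.isCompact (by positivity)
    (by rwa [mul_div_cancel₀ _ two_ne_zero])
  refine lt_of_le_of_lt ?_ (lintegral_exp_neg_mul_norm_lt_top (half_pos hε) B)
  refine (setLIntegral_le_lintegral C _).trans (lintegral_mono fun y => ?_)
  refine ENNReal.ofReal_le_ofReal (Real.exp_le_exp.2 ?_)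
  have := hB y
  rw [inner_axisPoint] at this
  linarith

theorem tiltedMass_le (hC : MeasurableSet C) {x x' : ℝ}
    (h : ∀ y ∈ C, x * y 0 ≤ x' * y 0) : tiltedMass p K C x ≤ tiltedMass p K C x' :=
  setLIntegral_mono' hC fun y hy => ENNReal.ofReal_le_ofReal
    (Real.exp_le_exp.2 (sub_le_sub_right (h y hy) _))

theorem tiltedMass_rightHalf_mono {x x' : ℝ} (h : x ≤ x') :
    tiltedMass p K rightHalf x ≤ tiltedMass p K rightHalf x' :=
  tiltedMass_le isOpen_rightHalf.measurableSet fun _ hy =>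
    mul_le_mul_of_nonneg_right h (le_of_lt hy)

theorem tiltedMass_leftHalf_anti {x x' : ℝ} (h : x ≤ x') :
    tiltedMass p K leftHalf x' ≤ tiltedMass p K leftHalf x :=
  tiltedMass_le isOpen_leftHalf.measurableSet fun _ hy =>
    mul_le_mul_of_nonpos_right h (le_of_lt hy)

/-- Dominated convergence: for `t` within `ε` of `x`, `t y₀` is at most the larger of `(x - ε) y₀`
and `(x + ε) y₀`, so the sum of the two extreme densities dominates. -/
theorem continuousAt_tiltedMass (hp : 0 < p) (hK : IsCenteredBody K) (C : Set Plane) {x : ℝ}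
    (hx : axisPoint x ∈ interior K) : ContinuousAt (tiltedMass p K C) x := by
  have hnhds : axisPoint ⁻¹' interior K ∈ nhds x :=
    continuous_axisPoint.continuousAt.preimage_mem_nhds (isOpen_interior.mem_nhds hx)
  obtain ⟨ε, hε, hball⟩ := Metric.nhds_basis_closedBall.mem_iff.1 hnhds
  rw [Real.closedBall_eq_Icc] at hball
  have h1 : axisPoint (x - ε) ∈ interior K := hball ⟨le_rfl, by linarith⟩
  have h2 : axisPoint (x + ε) ∈ interior K := hball ⟨by linarith, le_rfl⟩
  refine tendsto_lintegral_filter_of_dominated_convergence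
    (fun y => ENNReal.ofReal (Real.exp ((x - ε) * y 0 - lpSupport p K y)) +
      ENNReal.ofReal (Real.exp ((x + ε) * y 0 - lpSupport p K y)))
    (Filter.Eventually.of_forall fun t => measurable_tilted hK t) ?_ ?_ ?_
  · filter_upwards [Icc_mem_nhds (by linarith : x - ε < x) (by linarith : x < x + ε)] with t ht
    refine Filter.Eventually.of_forall fun y => ?_
    rcases le_total 0 (y 0) with hy | hy
    · exact (ENNReal.ofReal_le_ofReal (Real.exp_le_exp.2 (sub_le_sub_right
        (mul_le_mul_of_nonneg_right ht.2 hy) _))).trans le_add_self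
    · exact (ENNReal.ofReal_le_ofReal (Real.exp_le_exp.2 (sub_le_sub_right
        (mul_le_mul_of_nonpos_right ht.1 hy) _))).trans le_self_add
  · rw [lintegral_add_left (measurable_tilted hK _)]
    exact ENNReal.add_ne_top.2
      ⟨(tiltedMass_lt_top hp hK C h1).ne, (tiltedMass_lt_top hp hK C h2).ne⟩
  · refine Filter.Eventually.of_forall fun y => ?_
    exact (ENNReal.continuous_ofReal.comp
      (by fun_prop : Continuous fun t : ℝ => Real.exp (t * y 0 - lpSupport p K y))).tendsto x

theorem exists_supporting_normal (hK : Convex ℝ K) (hne : (interior K).Nonempty) {q : Plane}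
    (hq : q ∉ interior K) : ∃ ν : Plane, ν ≠ 0 ∧ ∀ x ∈ K, inner ℝ x ν ≤ inner ℝ q ν := by
  obtain ⟨f, hf⟩ := geometric_hahn_banach_open_point hK.interior isOpen_interior hq
  set ν := (InnerProductSpace.toDual ℝ Plane).symm f with hν
  have hfν : ∀ x, f x = inner ℝ x ν := fun x => by
    rw [real_inner_comm, hν, InnerProductSpace.toDual_symm_apply]
  refine ⟨ν, ?_, fun x hx => ?_⟩
  · intro h0
    obtain ⟨a, ha⟩ := hne
    have := hf a ha
    simp [hfν, h0] at this
  · have hx' : x ∈ closure (interior K) := by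
      rw [hK.closure_interior_eq_closure_of_nonempty_interior hne]
      exact subset_closure hx
    have hcl : closure (interior K) ⊆ {x | f x ≤ f q} :=
      closure_minimal (fun a ha => (hf a ha).le) (isClosed_le f.continuous continuous_const)
    simpa [hfν] using hcl hx'

/-- Let `ν` be normal to a line through `q` with `K` on one side. Near the ray spanned by `ν`,
`h_{p,K}(y)` exceeds `⟨q,y⟩` by at most a constant, so the integrand is bounded below on a set of
infinite area. -/
theorem lintegral_exp_inner_sub_lpSupport_eq_top (hp : 0 < p) (hK : IsCenteredBody K)
    {q : Plane} (hq : q ∉ interior K) :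
    ∫⁻ y : Plane, ENNReal.ofReal (Real.exp (inner ℝ q y - lpSupport p K y)) = ∞ := by
  obtain ⟨ν, hν, hsup⟩ := exists_supporting_normal hK.convex ⟨0, hK.zero_mem⟩ hq
  obtain ⟨D, hD⟩ := hK.isCompact.isBounded.subset_closedBall q
  have hν' : 0 < ‖ν‖ := norm_pos_iff.2 hν
  set δ := ‖ν‖ / 2 with hδ
  have hδ0 : 0 < δ := by positivity
  -- Consecutive centres are `‖ν‖ = 2δ` apart, so these congruent balls are disjoint.
  set S : ℕ → Set Plane := fun n => Metric.ball ((n : ℝ) • ν) δ with hS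
  have hdisj : Pairwise (Function.onFun Disjoint S) := by
    intro m n hmn
    refine Metric.ball_disjoint_ball ?_
    rw [dist_eq_norm, ← sub_smul, norm_smul, hδ, add_halves]
    have h1 : (1 : ℝ) ≤ ‖(m : ℝ) - n‖ := by
      rw [Real.norm_eq_abs]
      have : (1 : ℤ) ≤ |(m : ℤ) - n| := Int.one_le_abs (by omega)
      exact_mod_cast this
    nlinarith
  have hlow : ∀ y ∈ ⋃ n, S n, ENNReal.ofReal (Real.exp (-(D * δ))) ≤
      ENNReal.ofReal (Real.exp (inner ℝ q y - lpSupport p K y)) := by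
    intro y hy
    obtain ⟨n, hn⟩ := mem_iUnion.1 hy
    refine ENNReal.ofReal_le_ofReal (Real.exp_le_exp.2 ?_)
    have hle : lpSupport p K y ≤ inner ℝ q y + D * δ := by
      refine lpSupport_le hp hK.isCompact hK.volume_pos fun x hx => ?_
      have h1 : inner ℝ (x - q) y = n * inner ℝ (x - q) ν + inner ℝ (x - q) (y - (n : ℝ) • ν) := by
        rw [inner_sub_right, real_inner_smul_right]; ring
      have h2 : (inner ℝ (x - q) ν : ℝ) ≤ 0 := by
        rw [inner_sub_left]; linarith [hsup x hx]
      have h3 : ‖x - q‖ ≤ D := mem_closedBall_iff_norm.1 (hD hx)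
      have h4 : ‖y - (n : ℝ) • ν‖ ≤ δ := (mem_ball_iff_norm.1 hn).le
      have h5 := real_inner_le_norm (x - q) (y - (n : ℝ) • ν)
      have h6 : ‖x - q‖ * ‖y - (n : ℝ) • ν‖ ≤ D * δ :=
        mul_le_mul h3 h4 (norm_nonneg _) ((norm_nonneg _).trans h3)
      have h7 := mul_nonpos_of_nonneg_of_nonpos (Nat.cast_nonneg (α := ℝ) n) h2
      rw [inner_sub_left] at h1
      linarith
    linarith
  rw [eq_top_iff]
  calc ∞ = ENNReal.ofReal (Real.exp (-(D * δ))) * volume (⋃ n, S n) := by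
        rw [measure_iUnion hdisj fun n => measurableSet_ball]
        simp only [hS, Measure.addHaar_ball_center]
        rw [ENNReal.tsum_const_eq_top_of_ne_zero (Metric.measure_ball_pos volume _ hδ0).ne',
          ENNReal.mul_top (by simp [Real.exp_pos])]
    _ = ∫⁻ _y in ⋃ n, S n, ENNReal.ofReal (Real.exp (-(D * δ))) := by simp
    _ ≤ ∫⁻ y in ⋃ n, S n, ENNReal.ofReal (Real.exp (inner ℝ q y - lpSupport p K y)) :=
        setLIntegral_mono' (MeasurableSet.iUnion fun n => measurableSet_ball) hlow
    _ ≤ _ := setLIntegral_le_lintegral _ _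

/-- The total mass diverges, and off `C` the tilt only decreases the density `e^{-h_{p,K}}`, which
is integrable since the origin is interior. The divergence therefore occurs on `C`. -/
theorem tiltedMass_eq_top (hp : 0 < p) (hK : IsCenteredBody K) (hC : MeasurableSet C) {c : ℝ}
    (hc : axisPoint c ∉ interior K) (hCc : ∀ y ∉ C, c * y 0 ≤ 0) : tiltedMass p K C c = ∞ := by
  have htot := lintegral_exp_inner_sub_lpSupport_eq_top hp hK hc
  simp only [inner_axisPoint] at htot
  rw [← lintegral_add_compl _ hC, ENNReal.add_eq_top] at htot
  refine htot.resolve_right (ne_of_lt ?_)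
  refine lt_of_le_of_lt (tiltedMass_le (x' := 0) hC.compl fun y hy => ?_)
    (tiltedMass_lt_top hp hK Cᶜ (x := 0) (by rw [axisPoint_zero]; exact hK.zero_mem))
  simpa using hCc y hy

/-- Fatou's lemma: a bound `M` on the masses along `t c` with `t → 1` would pass to the mass at `c`,
which is infinite. -/
theorem exists_lt_tiltedMass (hp : 0 < p) (hK : IsCenteredBody K) (hC : MeasurableSet C) {c : ℝ}
    (hc : axisPoint c ∉ interior K) (hCc : ∀ y ∉ C, c * y 0 ≤ 0) {M : ℝ≥0∞} (hM : M < ∞) :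
    ∃ t ∈ Ico (0 : ℝ) 1, M < tiltedMass p K C (t * c) := by
  by_contra! h
  set t : ℕ → ℝ := fun n => 1 - 1 / ((n : ℝ) + 1) with ht
  have ht1 : ∀ n, t n ∈ Ico (0 : ℝ) 1 := by
    intro n
    have h1 : (0 : ℝ) < 1 / ((n : ℝ) + 1) := by positivity
    have h2 : 1 / ((n : ℝ) + 1) ≤ 1 := by
      rw [div_le_one (by positivity)]; linarith [Nat.cast_nonneg (α := ℝ) n]
    exact ⟨by simp only [ht]; linarith, by simp only [ht]; linarith⟩
  have htl : Filter.Tendsto (fun n => t n * c) Filter.atTop (nhds c) := by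
    have := (tendsto_one_div_add_atTop_nhds_zero_nat (𝕜 := ℝ)).const_sub 1 |>.mul_const c
    simpa [ht] using this
  have hfatou := lintegral_liminf_le (μ := volume.restrict C) (u := Filter.atTop)
    fun n => measurable_tilted (p := p) hK (t n * c)
  have hlim : ∀ y : Plane, Filter.liminf (fun n => ENNReal.ofReal
      (Real.exp (t n * c * y 0 - lpSupport p K y))) Filter.atTop =
      ENNReal.ofReal (Real.exp (c * y 0 - lpSupport p K y)) := fun y =>
    (((ENNReal.continuous_ofReal.comp
      (by fun_prop : Continuous fun s : ℝ => Real.exp (s * y 0 - lpSupport p K y))).tendsto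
        c).comp htl).liminf_eq
  simp only [hlim] at hfatou
  have hle : tiltedMass p K C c ≤ M := hfatou.trans
    (Filter.liminf_le_of_frequently_le' (Filter.Frequently.of_forall fun n => h (t n) (ht1 n)))
  rw [tiltedMass_eq_top hp hK hC hc hCc] at hle
  exact absurd hM (not_lt.2 hle)

end TiltedMass

/-! ### Balancing the two bodies by the intermediate value theorem. -/

section Balance

variable {p : ℝ≥0∞} {K K' : Set Plane}

/-- The translations `x` for which `(x, 0)` is interior to `K` and `(-x, 0)` to `K'`. -/
def admissible (K K' : Set Plane) : Set ℝ :=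
  {x | axisPoint x ∈ interior K ∧ axisPoint (-x) ∈ interior K'}

theorem isOpen_admissible : IsOpen (admissible K K') :=
  (isOpen_interior.preimage continuous_axisPoint).inter
    (isOpen_interior.preimage (continuous_axisPoint.comp continuous_neg))

theorem convex_preimage_axisPoint (hK : Convex ℝ K) : Convex ℝ (axisPoint ⁻¹' interior K) := by
  intro x hx y hy a b ha hb hab
  have h : axisPoint (a • x + b • y) = a • axisPoint x + b • axisPoint y := by
    ext i; fin_cases i <;> simp [axisPoint]
  rw [mem_preimage, h]
  exact hK.interior hx hy ha hb hab

theorem ordConnected_admissible (hK : Convex ℝ K) (hK' : Convex ℝ K') :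
    OrdConnected (admissible K K') := by
  have h1 := (convex_preimage_axisPoint hK).ordConnected
  have h2 := (convex_preimage_axisPoint hK').ordConnected
  exact ⟨fun x hx y hy z hz =>
    ⟨h1.out hx.1 hy.1 hz, h2.out hy.2 hx.2 ⟨neg_le_neg hz.2, neg_le_neg hz.1⟩⟩⟩

theorem zero_mem_admissible (hK : IsCenteredBody K) (hK' : IsCenteredBody K') :
    (0 : ℝ) ∈ admissible K K' :=
  ⟨by rw [axisPoint_zero]; exact hK.zero_mem, by rw [neg_zero, axisPoint_zero]; exact hK'.zero_mem⟩

theorem bddAbove_admissible (hK : IsCenteredBody K) : BddAbove (admissible K K') := by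
  obtain ⟨D, hD⟩ := hK.isCompact.isBounded.subset_closedBall 0
  refine ⟨D, fun x hx => ?_⟩
  have h1 : ‖axisPoint x‖ ≤ D := by simpa using hD (interior_subset hx.1)
  have h2 : ‖axisPoint x 0‖ ≤ ‖axisPoint x‖ := PiLp.norm_apply_le _ _
  exact (le_abs_self x).trans (le_trans (by simpa [axisPoint] using h2) h1)

theorem exists_nonneg_admissible_mul_le (hp : 0 < p) (hK : IsCenteredBody K)
    (hK' : IsCenteredBody K') :
    ∃ t ∈ admissible K K', 0 ≤ t ∧
      tiltedMass p K leftHalf t * tiltedMass p K' rightHalf (-t) ≤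
        tiltedMass p K rightHalf t * tiltedMass p K' leftHalf (-t) := by
  have h0 := zero_mem_admissible hK hK'
  have hlub := isLUB_csSup ⟨0, h0⟩ (bddAbove_admissible (K' := K') hK)
  set c := sSup (admissible K K') with hc
  -- The supremum of an open set of reals does not belong to it; this forces one of the two points
  -- onto or outside the boundary of its body.
  have hcmem : c ∉ admissible K K' := by
    intro h
    obtain ⟨ε, hε, hball⟩ := Metric.nhds_basis_closedBall.mem_iff.1 (isOpen_admissible.mem_nhds h)
    rw [Real.closedBall_eq_Icc] at hball
    linarith [hlub.1 (hball ⟨by linarith, le_rfl⟩)]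
  have hc0 : 0 < c := lt_of_le_of_ne (hlub.1 h0) fun h => hcmem (h ▸ h0)
  have hadm : ∀ t ∈ Ico (0 : ℝ) 1, t * c ∈ admissible K K' ∧ 0 ≤ t * c := by
    intro t ht
    have htc : t * c < c := by nlinarith [ht.2]
    have ht0 : 0 ≤ t * c := mul_nonneg ht.1 hc0.le
    obtain ⟨b, hb, hlt, -⟩ := hlub.exists_between htc
    exact ⟨(ordConnected_admissible hK.convex hK'.convex).out h0 hb ⟨ht0, hlt.le⟩, ht0⟩
  -- By monotonicity `B` bounds the left-hand product at every `t ≥ 0`, so it is enough for the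
  -- right-hand product to reach `B`.
  set B := tiltedMass p K leftHalf 0 * tiltedMass p K' rightHalf 0 with hB
  have h0K : axisPoint 0 ∈ interior K := h0.1
  have h0K' : axisPoint 0 ∈ interior K' := by simpa using h0.2
  have hBtop : B < ∞ :=
    ENNReal.mul_lt_top (tiltedMass_lt_top hp hK _ h0K) (tiltedMass_lt_top hp hK' _ h0K')
  suffices h : ∃ t ∈ Ico (0 : ℝ) 1,
      B ≤ tiltedMass p K rightHalf (t * c) * tiltedMass p K' leftHalf (-(t * c)) by
    obtain ⟨t, ht, hle⟩ := h
    obtain ⟨hta, ht0⟩ := hadm t ht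
    refine ⟨t * c, hta, ht0, le_trans ?_ hle⟩
    exact mul_le_mul' (tiltedMass_leftHalf_anti ht0)
      (tiltedMass_rightHalf_mono (neg_nonpos.2 ht0))
  -- In either case one factor of the right-hand product is unbounded, and the other is at least its
  -- positive value at `0`. Dividing `B` by that value gives the threshold to exceed.
  by_cases hcK : axisPoint c ∈ interior K
  · have hcK' : axisPoint (-c) ∉ interior K' := fun h => hcmem ⟨hcK, h⟩
    have hpos := tiltedMass_pos (p := p) hK isOpen_rightHalf rightHalf_nonempty 0
    obtain ⟨t, ht, hlt⟩ := exists_lt_tiltedMass hp hK' isOpen_leftHalf.measurableSet hcK'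
      (fun y hy => mul_nonpos_of_nonpos_of_nonneg (neg_nonpos.2 hc0.le) (not_lt.1 hy))
      (ENNReal.div_lt_top hBtop.ne hpos.ne')
    refine ⟨t, ht, ?_⟩
    rw [mul_neg] at hlt
    calc B = tiltedMass p K rightHalf 0 * (B / tiltedMass p K rightHalf 0) :=
          (ENNReal.mul_div_cancel hpos.ne' (tiltedMass_lt_top hp hK _ h0K).ne).symm
      _ ≤ _ := mul_le_mul' (tiltedMass_rightHalf_mono (hadm t ht).2) hlt.le
  · have hpos := tiltedMass_pos (p := p) hK' isOpen_leftHalf leftHalf_nonempty 0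
    obtain ⟨t, ht, hlt⟩ := exists_lt_tiltedMass hp hK isOpen_rightHalf.measurableSet hcK
      (fun y hy => mul_nonpos_of_nonneg_of_nonpos hc0.le (not_lt.1 hy))
      (ENNReal.div_lt_top hBtop.ne hpos.ne')
    refine ⟨t, ht, ?_⟩
    calc B = B / tiltedMass p K' leftHalf 0 * tiltedMass p K' leftHalf 0 :=
          (ENNReal.div_mul_cancel hpos.ne' (tiltedMass_lt_top hp hK' _ h0K').ne).symm
      _ ≤ _ := mul_le_mul' hlt.le (tiltedMass_leftHalf_anti (neg_nonpos.2 (hadm t ht).2))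

theorem continuousOn_tiltedMass_mul (hp : 0 < p) (hK : IsCenteredBody K)
    (hK' : IsCenteredBody K') (C C' : Set Plane) :
    ContinuousOn (fun t => tiltedMass p K C t * tiltedMass p K' C' (-t)) (admissible K K') := by
  intro t ht
  refine ContinuousAt.continuousWithinAt (ENNReal.Tendsto.mul
    (continuousAt_tiltedMass hp hK C ht.1) (Or.inr (tiltedMass_lt_top hp hK' C' ht.2).ne)
    (ContinuousAt.comp (g := tiltedMass p K' C') (continuousAt_tiltedMass hp hK' C' ht.2)
      continuous_neg.continuousAt) (Or.inr (tiltedMass_lt_top hp hK C ht.1).ne))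

theorem exists_admissible_mul_eq (hp : 0 < p) (hK : IsCenteredBody K)
    (hK' : IsCenteredBody K') :
    ∃ t ∈ admissible K K',
      tiltedMass p K leftHalf t * tiltedMass p K' rightHalf (-t) =
        tiltedMass p K rightHalf t * tiltedMass p K' leftHalf (-t) := by
  obtain ⟨a, ha, -, hle⟩ := exists_nonneg_admissible_mul_le hp hK hK'
  -- With the bodies exchanged, the parameter `b` corresponds to `-b` in the original order, where
  -- the inequality is reversed.
  obtain ⟨b, hb, -, hle'⟩ := exists_nonneg_admissible_mul_le hp hK' hK
  have hb' : -b ∈ admissible K K' := ⟨hb.2, by rw [neg_neg]; exact hb.1⟩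
  refine (ordConnected_admissible hK.convex hK'.convex).isPreconnected.intermediate_value₂ ha hb'
    (continuousOn_tiltedMass_mul hp hK hK' _ _) (continuousOn_tiltedMass_mul hp hK hK' _ _)
    hle ?_
  rw [neg_neg, mul_comm, mul_comm (tiltedMass p K leftHalf (-b))]
  exact hle'

theorem half_tiltedMass_mem_Ioo (hp : 0 < p) (hK : IsCenteredBody K) {C : Set Plane}
    (hC : IsOpen C) (hne : C.Nonempty) {x : ℝ} (hx : axisPoint x ∈ interior K) :
    tiltedMass p K C x / 2 ∈ Ioo 0 ∞ :=
  ⟨ENNReal.half_pos (tiltedMass_pos hK hC hne x).ne',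
    ENNReal.div_lt_top (tiltedMass_lt_top hp hK C hx).ne two_ne_zero⟩

end Balance

end

/-! ### Application to the sliding polygon. -/

/-- Every `P(s)` contains the hull of the fixed vertices, which already has the origin in its
interior. -/
theorem SlidingPolygon.isCenteredBody_slide {k : ℕ} (P : SlidingPolygon k) (s : ℝ) :
    IsCenteredBody (P.slide s) where
  isCompact := (finite_range _).isCompact_convexHull ℝ
  convex := convex_convexHull ℝ _
  zero_mem := by
    refine interior_mono (convexHull_mono ?_) P.zero_mem
    rintro _ ⟨i, hi, rfl⟩
    exact ⟨i, Function.update_of_ne hi _ _⟩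

theorem mainTheorem10 (p : ℝ≥0∞) (hp : 0 < p) (k : ℕ) (P : SlidingPolygon k) (s s' : ℝ)
    (hs : s ∈ Set.Icc P.xiLeft P.xiRight) (hs' : s' ∈ Set.Icc P.xiLeft P.xiRight) :
    ∃ x₀ : ℝ,
      (!₂[x₀, 0] : Plane) ∈ interior (P.slide s) ∧
      (!₂[-x₀, 0] : Plane) ∈ interior (P.slide s') ∧
      rightArea p (translateSub (P.slide s) !₂[x₀, 0]) ∈ Set.Ioo 0 ∞ ∧
      leftArea p (translateSub (P.slide s) !₂[x₀, 0]) ∈ Set.Ioo 0 ∞ ∧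
      rightArea p (translateSub (P.slide s') !₂[-x₀, 0]) ∈ Set.Ioo 0 ∞ ∧
      leftArea p (translateSub (P.slide s') !₂[-x₀, 0]) ∈ Set.Ioo 0 ∞ ∧
      rightArea p (translateSub (P.slide s) !₂[x₀, 0]) /
          leftArea p (translateSub (P.slide s) !₂[x₀, 0]) =
        rightArea p (translateSub (P.slide s') !₂[-x₀, 0]) /
          leftArea p (translateSub (P.slide s') !₂[-x₀, 0]) := by
  have hK := P.isCenteredBody_slide s
  have hK' := P.isCenteredBody_slide s'
  obtain ⟨x, hx, heq⟩ := exists_admissible_mul_eq hp hK hK'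
  have hR := half_tiltedMass_mem_Ioo hp hK isOpen_rightHalf rightHalf_nonempty hx.1
  have hL := half_tiltedMass_mem_Ioo hp hK isOpen_leftHalf leftHalf_nonempty hx.1
  have hR' := half_tiltedMass_mem_Ioo hp hK' isOpen_rightHalf rightHalf_nonempty hx.2
  have hL' := half_tiltedMass_mem_Ioo hp hK' isOpen_leftHalf leftHalf_nonempty hx.2
  refine ⟨x, hx.1, hx.2, ?_⟩
  rw [show (!₂[x, 0] : Plane) = axisPoint x from rfl,
    show (!₂[-x, 0] : Plane) = axisPoint (-x) from rfl, rightArea_eq hp hK, leftArea_eq hp hK,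
    rightArea_eq hp hK', leftArea_eq hp hK']
  refine ⟨hR, hL, hR', hL', ?_⟩
  -- Cross-multiplication in `ℝ≥0∞` needs both left areas nonzero and finite; the factors `1/2` then
  -- appear equally on both sides.
  rw [ENNReal.div_eq_div_iff hL'.1.ne' hL'.2.ne hL.1.ne' hL.2.ne]
  simp only [div_eq_mul_inv]
  rw [mul_mul_mul_comm, mul_comm (tiltedMass p (P.slide s') leftHalf (-x)), ← heq,
    mul_mul_mul_comm]
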